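/- Let $G$ be a (discrete) abelian group with identity $e$, and let $A$ be a $C^*$-algebra (not necessarily unital) that is topologically $G$-graded. That is, there are linearly independent closed subspaces $\{A_g : g\in G\}$ of $A$ such that $a\in A_g$ and $b\in A_h$ imply $ab\in A_{gh}$ and $a^*\in A_{g^{-1}}$, the algebraic direct sum $\bigoplus_{g\in G}A_g$ is norm-dense in $A$, and there is a bounded linear map $F:A\to A$ such that $F(a)=a$ for all $a\in A_e$ and $F(a)=0$ for all $a\in A_g$ with $g\neq e$. Then: (1) $F$ is a conditional expectation of $A$ onto the $C^*$-subalgebra $A_e$: it takes values in $A_e$, is the identity on $A_e$, is contractive and positive, and satisfies $F(ba)=bF(a)$ and $F(ab)=F(a)b$ for all $a\in A$, $b\in A_e$. (2) $F$ is faithful: if $a\in A$ and $F(a^*a)=0$, then $a=0$. (3) $F$ is the Haar average of the dual action: there is a strongly continuous action $\alpha$ of the compact Pontryagin dual $\widehat G$ by $*$-automorphisms of $A$ such that $\alpha_\gamma(a)=\gamma(g)a$ for all $\gamma\in\widehat G$, $g\in G$, $a\in A_g$, and $$F(a)=\int_{\widehat G}\alpha_\gamma(a)\,d\gamma\qquad\text{for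 all } a\in A,$$ where the integral is with respect to normalised Haar measure on $\widehat G$. -/

import Mathlib

/-- A grading of a C⋆-algebra `A` by a group `G`: linearly independent closed subspaces `𝒜 g` with
`𝒜 g * 𝒜 h ⊆ 𝒜 (g * h)` and `star (𝒜 g) ⊆ 𝒜 g⁻¹`, whose linear span is norm-dense in `A`. -/
structure IsCStarGrading {G A : Type*} [Group G] [NonUnitalCStarAlgebra A]
    (𝒜 : G → Submodule ℂ A) : Prop where
  isClosed : ∀ g, IsClosed (𝒜 g : Set A)
  independent : iSupIndep 𝒜
  mul_mem : ∀ {g h : G} {a b : A}, a ∈ 𝒜 g → b ∈ 𝒜 h → a * b ∈ 𝒜 (g * h)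
  star_mem : ∀ {g : G} {a : A}, a ∈ 𝒜 g → star a ∈ 𝒜 g⁻¹
  dense : Dense ((⨆ g, 𝒜 g : Submodule ℂ A) : Set A)

/-- The fibre over the identity of a grading, as a ⋆-subalgebra of `A`. -/
def IsCStarGrading.unitFibre {G A : Type*} [Group G] [NonUnitalCStarAlgebra A]
    {𝒜 : G → Submodule ℂ A} (h : IsCStarGrading 𝒜) : NonUnitalStarSubalgebra ℂ A where
  toSubmodule := 𝒜 1
  mul_mem' := fun {a b} ha hb => by
    have := h.mul_mem (g := 1) (h := 1) (a := a) (b := b) ha hb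
    rwa [mul_one] at this
  star_mem' := fun {a} ha => by
    have := h.star_mem (g := 1) (a := a) ha
    rwa [inv_one] at this

/-- `E` is a conditional expectation of the C⋆-algebra `A` onto the C⋆-subalgebra `B`:
a positive contractive linear map with values in `B`, which is the identity on `B` (so `E` is
idempotent with range `B`) and is `B`-bimodular. The positive elements of `A` and `B` are
the elements of the form `star a * a`. -/
structure IsConditionalExpectation {A : Type*} [NonUnitalCStarAlgebra A]
    (B : NonUnitalStarSubalgebra ℂ A) (E : A →L[ℂ] A) : Prop where
  isClosed : IsClosed (B : Set A)
  apply_mem : ∀ a, E a ∈ B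
  apply_eq_self : ∀ b ∈ B, E b = b
  norm_apply_le : ∀ a, ‖E a‖ ≤ ‖a‖
  positive : ∀ a, ∃ b ∈ B, E (star a * a) = star b * b
  map_mul_left : ∀ b ∈ B, ∀ a, E (b * a) = b * E a
  map_mul_right : ∀ b ∈ B, ∀ a, E (a * b) = E a * b

/-- A strongly continuous action of a topological group `Γ` by ⋆-automorphisms of `A`. -/
structure IsStronglyContinuousAction {Γ A : Type*} [Group Γ] [TopologicalSpace Γ]
    [NonUnitalCStarAlgebra A] (α : Γ → (A ≃⋆ₐ[ℂ] A)) : Prop where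
  map_one : ∀ a, α 1 a = a
  map_mul : ∀ γ χ a, α (γ * χ) a = α γ (α χ a)
  continuous : ∀ a, Continuous fun γ => α γ a

/-- The dual group is equipped with its Borel σ-algebra. -/
noncomputable instance PontryaginDual.instMeasurableSpaceBorel {G : Type*} [Monoid G] [TopologicalSpace G] :
    MeasurableSpace (PontryaginDual G) :=
  borel _

instance PontryaginDual.instBorelSpace {G : Type*} [Monoid G] [TopologicalSpace G] :
    BorelSpace (PontryaginDual G) :=
  ⟨rfl⟩

/-- Normalised Haar measure (total mass one) on the compact dual of a discrete group. -/
noncomputable def dualHaar (G : Type*) [CommGroup G] [TopologicalSpace G] [DiscreteTopology G] :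
    MeasureTheory.Measure (PontryaginDual G) :=
  MeasureTheory.Measure.haarMeasure ⊤

/-! For a character `γ`, multiplying each fibre `𝒜 g` by `γ g` is multiplicative and ⋆-preserving on
the algebraic direct sum; the point is that it is contractive. Applying `F` to `star (a g) * ∑ a h`
isolates `star (a g) * a g`, so each component is bounded by `‖F‖` times the sum, and twisting an
element supported on `S` costs at most a factor `S.card * ‖F‖`.

To remove this factor, apply the bound to the `2 ^ k`-th power of `star p * p`: norms are raised to
that power exactly by the C⋆-identity, while supports grow only polynomially since `G` is
commutative. Taking roots leaves the constant one (`IsCStarGrading.norm_snd_le`).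

The twists thus extend to ⋆-automorphisms of `A`. Their Haar average agrees with `F` on every fibre,
hence everywhere; contractivity, positivity and faithfulness are read off the integral. -/

open Filter Topology MeasureTheory
open scoped Pointwise

/-! ### Polynomial growth and the removal of polynomial factors -/

/-- Balls for a finite subset of a commutative group grow polynomially. -/
theorem Finset.card_pow_le_succ_pow {G : Type*} [CommGroup G] [DecidableEq G] (S : Finset G)
    (n : ℕ) : (S ^ n).card ≤ (n + 1) ^ S.card := by
  -- By commutativity a product of `n` elements of `S` depends only on the multiplicities, each at
  -- most `n`.
  have hsub : S ^ n ⊆ (Fintype.piFinset fun _ : S => Finset.range (n + 1)).image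
      (fun f => ∏ s : S, (s : G) ^ f s) := by
    induction n with
    | zero =>
      intro x hx
      simp only [pow_zero, Finset.mem_one] at hx
      simp only [Finset.mem_image, Fintype.mem_piFinset, Finset.mem_range]
      exact ⟨fun _ => 0, by simp, by simp [hx]⟩
    | succ n ih =>
      intro x hx
      rw [pow_succ, Finset.mem_mul] at hx
      obtain ⟨y, hy, s, hs, rfl⟩ := hx
      obtain ⟨f, hf, rfl⟩ := Finset.mem_image.1 (ih hy)
      simp only [Fintype.mem_piFinset, Finset.mem_range] at hf
      simp only [Finset.mem_image, Fintype.mem_piFinset, Finset.mem_range]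
      refine ⟨f + Pi.single ⟨s, hs⟩ 1, fun a => ?_, ?_⟩
      · have := hf a
        by_cases h : a = ⟨s, hs⟩
        · subst h; simp; omega
        · simp [h]; omega
      · simp only [Pi.add_apply, pow_add, Finset.prod_mul_distrib]
        congr 1
        rw [Finset.prod_eq_single ⟨s, hs⟩]
        · simp
        · intro b _ hb; simp [hb]
        · simp
  refine (Finset.card_le_card hsub).trans (Finset.card_image_le.trans ?_)
  simp

/-- If all powers `x ^ 2 ^ k` of a real number are bounded by those of `y` up to a factor growing
polynomially in the exponent, then `x ≤ y`. -/
theorem le_of_pow_two_pow_le_mul_pow {x y C : ℝ} (hy : 0 ≤ y) (m : ℕ)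
    (h : ∀ k : ℕ, x ^ 2 ^ k ≤ ((2 ^ k + 1 : ℕ) : ℝ) ^ m * C * y ^ 2 ^ k) : x ≤ y := by
  by_contra! hlt
  have hx : 0 < x := hy.trans_lt hlt
  rcases hy.eq_or_lt with rfl | hy
  · have := h 0
    simp at this
    linarith
  have hr : 1 < x / y := (one_lt_div hy).2 hlt
  -- The exponent `2 ^ k + 1` matches the base of the polynomial factor; the surplus `x / y` is
  -- absorbed into the constant below.
  have ht : Tendsto (fun k : ℕ => ((2 ^ k + 1 : ℕ) : ℝ) ^ m / (x / y) ^ (2 ^ k + 1)) atTop (𝓝 0) :=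
    (tendsto_pow_const_div_const_pow_of_one_lt m hr).comp
      ((tendsto_add_atTop_nat 1).comp (tendsto_pow_atTop_atTop_of_one_lt one_lt_two))
  have ht' := ht.mul_const (C * (x / y))
  rw [zero_mul] at ht'
  obtain ⟨k, hk⟩ := (ht'.eventually_lt_const one_pos).exists
  refine absurd (h k) (not_le.2 ?_)
  rw [div_mul_eq_mul_div, div_lt_one (by positivity), pow_succ, ← mul_assoc,
    mul_lt_mul_iff_left₀ (by positivity), div_pow, lt_div_iff₀ (by positivity)] at hk
  exact hk

theorem IsSelfAdjoint.norm_mul_self_iterate {A : Type*} [NonUnitalNormedRing A] [StarRing A]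
    [CStarRing A] {p : A} (hp : IsSelfAdjoint p) (k : ℕ) :
    IsSelfAdjoint ((fun x : A => x * x)^[k] p) ∧
      ‖(fun x : A => x * x)^[k] p‖ = ‖p‖ ^ 2 ^ k := by
  induction k with
  | zero => simpa using hp
  | succ k ih =>
    rw [Function.iterate_succ_apply']
    refine ⟨?_, ?_⟩
    · rw [isSelfAdjoint_iff, star_mul, ih.1.star_eq]
    · have := CStarRing.norm_star_mul_self (x := (fun x : A => x * x)^[k] p)
      rw [ih.1.star_eq] at this
      rw [this, ih.2, pow_succ, pow_mul, sq]

/-! ### Characters separate points -/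

/-- A character of a discrete commutative group that is nontrivial at a given nontrivial
element. -/
theorem PontryaginDual.exists_apply_ne_one {G : Type*} [CommGroup G] [TopologicalSpace G]
    [DiscreteTopology G] {g : G} (hg : g ≠ 1) : ∃ γ : PontryaginDual G, γ g ≠ 1 := by
  obtain ⟨c, hc⟩ := CharacterModule.exists_character_apply_ne_zero_of_ne_zero
    (a := Additive.ofMul g) (by simpa using hg)
  -- The character `c` takes values in `ℚ/ℤ`, which embeds in `ℝ/ℤ` and so in the circle.
  have hle : AddSubgroup.zmultiples (1 : ℚ) ≤
      (AddSubgroup.zmultiples (1 : ℝ)).comap (Rat.castHom ℝ).toAddMonoidHom := by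
    rw [AddSubgroup.zmultiples_le]
    exact ⟨1, by simp⟩
  let ι : AddCircle (1 : ℚ) →+ AddCircle (1 : ℝ) := QuotientAddGroup.map _ _ _ hle
  have hι : ∀ x, ι x = 0 → x = 0 := by
    intro x hx
    induction x using QuotientAddGroup.induction_on with
    | H q =>
      replace hx : ((Rat.castHom ℝ q : ℝ) : AddCircle (1 : ℝ)) = 0 := hx
      obtain ⟨n, hn⟩ := (AddCircle.coe_eq_zero_iff _).1 hx
      refine (AddCircle.coe_eq_zero_iff _).2 ⟨n, ?_⟩
      simp only [zsmul_eq_mul, mul_one, eq_ratCast] at hn ⊢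
      exact_mod_cast hn
  let γ : G →* Circle :=
    { toFun := fun x => AddCircle.toCircle (ι (c (Additive.ofMul x)))
      map_one' := by simp
      map_mul' := fun x y => by simp [AddCircle.toCircle_add] }
  refine ⟨(⟨γ, continuous_of_discreteTopology⟩ : G →ₜ* Circle), fun h => hc (hι _ ?_)⟩
  refine AddCircle.injective_toCircle one_ne_zero ?_
  rw [AddCircle.toCircle_zero]
  exact h

/-! ### Contractivity of the twist -/

/-- The graph over the fibre at `g` of multiplication by `γ g`. -/
noncomputable def twistFibre {G A : Type*} [Group G] [NonUnitalCStarAlgebra A] (𝒜 : G → Submodule ℂ A)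
    (γ : G →* Circle) (g : G) : Submodule ℂ (A × A) :=
  (𝒜 g).map (LinearMap.id.prod ((γ g : ℂ) • LinearMap.id))

section
variable {G A : Type*} [CommGroup G] [NonUnitalCStarAlgebra A] {𝒜 : G → Submodule ℂ A}

theorem mem_twistFibre {γ : G →* Circle} {g : G} {p : A × A} :
    p ∈ twistFibre 𝒜 γ g ↔ p.1 ∈ 𝒜 g ∧ p.2 = (γ g : ℂ) • p.1 := by
  rw [twistFibre, Submodule.mem_map]
  constructor
  · rintro ⟨a, ha, rfl⟩
    exact ⟨ha, rfl⟩
  · rintro ⟨ha, h⟩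
    exact ⟨p.1, ha, Prod.ext rfl h.symm⟩

theorem IsCStarGrading.mul_mem_twistFibre (h𝒜 : IsCStarGrading 𝒜) {γ : G →* Circle} {g h : G}
    {p q : A × A} (hp : p ∈ twistFibre 𝒜 γ g) (hq : q ∈ twistFibre 𝒜 γ h) :
    p * q ∈ twistFibre 𝒜 γ (g * h) := by
  rw [mem_twistFibre] at *
  refine ⟨h𝒜.mul_mem hp.1 hq.1, ?_⟩
  rw [Prod.snd_mul, hp.2, hq.2, Prod.fst_mul, smul_mul_smul_comm, map_mul, Circle.coe_mul]

theorem IsCStarGrading.star_mem_twistFibre (h𝒜 : IsCStarGrading 𝒜) {γ : G →* Circle} {g : G}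
    {p : A × A} (hp : p ∈ twistFibre 𝒜 γ g) : star p ∈ twistFibre 𝒜 γ g⁻¹ := by
  rw [mem_twistFibre] at *
  refine ⟨h𝒜.star_mem hp.1, ?_⟩
  rw [Prod.snd_star, hp.2, Prod.fst_star, star_smul, map_inv, Circle.coe_inv_eq_conj,
    starRingEnd_apply]

theorem IsCStarGrading.mul_mem_iSup_twistFibre [DecidableEq G] (h𝒜 : IsCStarGrading 𝒜)
    {γ : G →* Circle} {S T : Finset G} {p q : A × A} (hp : p ∈ ⨆ g ∈ S, twistFibre 𝒜 γ g)
    (hq : q ∈ ⨆ g ∈ T, twistFibre 𝒜 γ g) : p * q ∈ ⨆ g ∈ S * T, twistFibre 𝒜 γ g := by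
  obtain ⟨μ, rfl⟩ := (Submodule.mem_iSup_finset_iff_exists_sum _ _).1 hp
  obtain ⟨ν, rfl⟩ := (Submodule.mem_iSup_finset_iff_exists_sum _ _).1 hq
  rw [Finset.sum_mul_sum]
  exact sum_mem fun g hg => sum_mem fun h hh =>
    Submodule.mem_iSup_of_mem (g * h) (Submodule.mem_iSup_of_mem (Finset.mul_mem_mul hg hh)
      (h𝒜.mul_mem_twistFibre (μ g).2 (ν h).2))

theorem IsCStarGrading.star_mem_iSup_twistFibre [DecidableEq G] (h𝒜 : IsCStarGrading 𝒜)
    {γ : G →* Circle} {S : Finset G} {p : A × A} (hp : p ∈ ⨆ g ∈ S, twistFibre 𝒜 γ g) :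
    star p ∈ ⨆ g ∈ S⁻¹, twistFibre 𝒜 γ g := by
  obtain ⟨μ, rfl⟩ := (Submodule.mem_iSup_finset_iff_exists_sum _ _).1 hp
  rw [star_sum]
  exact sum_mem fun g hg =>
    Submodule.mem_iSup_of_mem g⁻¹ (Submodule.mem_iSup_of_mem (Finset.inv_mem_inv hg)
      (h𝒜.star_mem_twistFibre (μ g).2))

theorem IsCStarGrading.iterate_mul_self_mem_iSup_twistFibre [DecidableEq G]
    (h𝒜 : IsCStarGrading 𝒜) {γ : G →* Circle} {S : Finset G} {p : A × A}
    (hp : p ∈ ⨆ g ∈ S, twistFibre 𝒜 γ g) (k : ℕ) :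
    ((fun x : A => x * x)^[k] p.1, (fun x : A => x * x)^[k] p.2) ∈
      ⨆ g ∈ S ^ 2 ^ k, twistFibre 𝒜 γ g := by
  induction k with
  | zero => simpa using hp
  | succ k ih =>
    have := h𝒜.mul_mem_iSup_twistFibre ih ih
    rw [← sq, ← pow_mul, ← pow_succ] at this
    simp only [Function.iterate_succ_apply']
    exact this

variable {F : A →L[ℂ] A}

/-- The component of a finite sum in a fibre is bounded by the sum. -/
theorem IsCStarGrading.norm_component_le (h𝒜 : IsCStarGrading 𝒜) (hF_one : ∀ a ∈ 𝒜 1, F a = a)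
    (hF_ne : ∀ g : G, g ≠ 1 → ∀ a ∈ 𝒜 g, F a = 0) {S : Finset G} {a : G → A}
    (ha : ∀ g, a g ∈ 𝒜 g) {g : G} (hg : g ∈ S) : ‖a g‖ ≤ ‖F‖ * ‖∑ h ∈ S, a h‖ := by
  have hmem : ∀ h, star (a g) * a h ∈ 𝒜 (g⁻¹ * h) := fun h => h𝒜.mul_mem (h𝒜.star_mem (ha g)) (ha h)
  -- Only the term `h = g` has degree one; `F` kills the others.
  have hFg : F (star (a g) * ∑ h ∈ S, a h) = star (a g) * a g := by
    rw [Finset.mul_sum, map_sum, Finset.sum_eq_single_of_mem g hg]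
    · exact hF_one _ (by simpa using hmem g)
    · exact fun h _ hne => hF_ne _ (by rwa [ne_eq, inv_mul_eq_one, eq_comm]) _ (hmem h)
  rcases (norm_nonneg (a g)).eq_or_lt with h0 | h0
  · rw [← h0]; positivity
  refine le_of_mul_le_mul_left ?_ h0
  calc ‖a g‖ * ‖a g‖ = ‖F (star (a g) * ∑ h ∈ S, a h)‖ := by
        rw [hFg, CStarRing.norm_star_mul_self]
    _ ≤ ‖F‖ * (‖star (a g)‖ * ‖∑ h ∈ S, a h‖) :=
        (F.le_opNorm _).trans (mul_le_mul_of_nonneg_left (norm_mul_le _ _) (norm_nonneg _))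
    _ = ‖a g‖ * (‖F‖ * ‖∑ h ∈ S, a h‖) := by rw [norm_star]; ring

theorem IsCStarGrading.norm_snd_le_card_mul (h𝒜 : IsCStarGrading 𝒜)
    (hF_one : ∀ a ∈ 𝒜 1, F a = a) (hF_ne : ∀ g : G, g ≠ 1 → ∀ a ∈ 𝒜 g, F a = 0)
    {γ : G →* Circle} {S : Finset G} {p : A × A} (hp : p ∈ ⨆ g ∈ S, twistFibre 𝒜 γ g) :
    ‖p.2‖ ≤ S.card * (‖F‖ * ‖p.1‖) := by
  obtain ⟨μ, rfl⟩ := (Submodule.mem_iSup_finset_iff_exists_sum _ _).1 hp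
  have hμ := fun g => mem_twistFibre.1 (μ g).2
  rw [Prod.snd_sum, Prod.fst_sum, ← nsmul_eq_mul]
  refine (norm_sum_le _ _).trans (Finset.sum_le_card_nsmul _ _ _ fun g hg => ?_)
  rw [(hμ g).2, norm_smul, Circle.norm_coe, one_mul]
  exact h𝒜.norm_component_le hF_one hF_ne (fun g => (hμ g).1) hg

/-- The crude cardinality bound, applied to high powers of `star p * p`, loses its constant in the
limit. -/
theorem IsCStarGrading.norm_snd_le (h𝒜 : IsCStarGrading 𝒜)
    (hF_one : ∀ a ∈ 𝒜 1, F a = a) (hF_ne : ∀ g : G, g ≠ 1 → ∀ a ∈ 𝒜 g, F a = 0)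
    {γ : G →* Circle} {p : A × A} (hp : p ∈ ⨆ g, twistFibre 𝒜 γ g) : ‖p.2‖ ≤ ‖p.1‖ := by
  classical
  obtain ⟨S, hS⟩ := Submodule.mem_iSup_iff_exists_finset.1 hp
  have hq := h𝒜.mul_mem_iSup_twistFibre (h𝒜.star_mem_iSup_twistFibre hS) hS
  have hle : ‖star p.2 * p.2‖ ≤ ‖star p.1 * p.1‖ := by
    -- `star p * p` is supported on `S⁻¹ * S`, whose cardinality bounds the degree of growth.
    refine le_of_pow_two_pow_le_mul_pow (norm_nonneg _) (S⁻¹ * S).card (C := ‖F‖) fun k => ?_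
    have h := h𝒜.norm_snd_le_card_mul hF_one hF_ne (h𝒜.iterate_mul_self_mem_iSup_twistFibre hq k)
    simp only [Prod.fst_mul, Prod.snd_mul, Prod.fst_star, Prod.snd_star,
      ((IsSelfAdjoint.star_mul_self _).norm_mul_self_iterate k).2] at h
    rw [mul_assoc]
    refine h.trans (mul_le_mul_of_nonneg_right ?_ (by positivity))
    exact_mod_cast Finset.card_pow_le_succ_pow _ _
  rw [CStarRing.norm_star_mul_self, CStarRing.norm_star_mul_self] at hle
  exact (mul_self_le_mul_self_iff (norm_nonneg _) (norm_nonneg _)).2 hle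

/-- The span of the fibrewise graphs is a priori only a linear relation; the norm bound makes it
single-valued and extends it by density. -/
theorem IsCStarGrading.exists_twist (h𝒜 : IsCStarGrading 𝒜)
    (hF_one : ∀ a ∈ 𝒜 1, F a = a) (hF_ne : ∀ g : G, g ≠ 1 → ∀ a ∈ 𝒜 g, F a = 0)
    (γ : G →* Circle) : ∃ T : A →L[ℂ] A, (∀ a, ‖T a‖ ≤ ‖a‖) ∧
      ∀ g, ∀ a ∈ 𝒜 g, T a = (γ g : ℂ) • a := by
  let K : Submodule ℂ (A × A) := ⨆ g, twistFibre 𝒜 γ g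
  let e : K →ₗ[ℂ] A := LinearMap.fst ℂ A A ∘ₗ K.subtype
  let f : K →ₗ[ℂ] A := LinearMap.snd ℂ A A ∘ₗ K.subtype
  have hmem : ∀ g, ∀ a ∈ 𝒜 g, (a, (γ g : ℂ) • a) ∈ K := fun g a ha =>
    Submodule.mem_iSup_of_mem g (mem_twistFibre.2 ⟨ha, rfl⟩)
  have hnorm : ∀ x, ‖f x‖ ≤ 1 * ‖e x‖ := fun x => by
    rw [one_mul]; exact h𝒜.norm_snd_le hF_one hF_ne x.2
  have hdense : DenseRange e := by
    refine h𝒜.dense.mono ?_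
    have : ⨆ g, 𝒜 g ≤ LinearMap.range e :=
      iSup_le fun g a ha => ⟨⟨_, hmem g a ha⟩, rfl⟩
    exact this
  refine ⟨f.extendOfNorm e, fun a => ?_, fun g a ha => ?_⟩
  · simpa using LinearMap.norm_extendOfNorm_apply_le hdense 1 hnorm a
  · exact LinearMap.extendOfNorm_eq hdense ⟨1, hnorm⟩ ⟨_, hmem g a ha⟩

/-- A closed additive submonoid containing all fibres is everything. -/
theorem IsCStarGrading.induction_on (h𝒜 : IsCStarGrading 𝒜) {P : A → Prop}
    (hP : IsClosed {a | P a}) (hadd : ∀ a b, P a → P b → P (a + b))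
    (hfibre : ∀ g, ∀ a ∈ 𝒜 g, P a) (a : A) : P a := by
  refine h𝒜.dense.induction (P := P) (fun x hx => ?_) hP a
  exact Submodule.iSup_induction 𝒜 (motive := P) hx hfibre (hfibre 1 0 (zero_mem _)) hadd

theorem IsCStarGrading.continuousLinearMap_ext (h𝒜 : IsCStarGrading 𝒜) {E : Type*}
    [NormedAddCommGroup E] [NormedSpace ℂ E]
    {S T : A →L[ℂ] E} (h : ∀ g, ∀ a ∈ 𝒜 g, S a = T a) : S = T :=
  ContinuousLinearMap.ext <| h𝒜.induction_on (isClosed_eq (by fun_prop) (by fun_prop))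
    (fun a b ha hb => by rw [map_add, map_add, ha, hb]) h

end

/-! ### The dual action -/

section
variable {G A : Type*} [CommGroup G] [NonUnitalCStarAlgebra A] {𝒜 : G → Submodule ℂ A}
  {F : A →L[ℂ] A}

theorem IsCStarGrading.exists_starAlgEquiv (h𝒜 : IsCStarGrading 𝒜)
    (hF_one : ∀ a ∈ 𝒜 1, F a = a) (hF_ne : ∀ g : G, g ≠ 1 → ∀ a ∈ 𝒜 g, F a = 0)
    (γ : G →* Circle) : ∃ α : A ≃⋆ₐ[ℂ] A, (∀ a, ‖α a‖ ≤ ‖a‖) ∧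
      ∀ g, ∀ a ∈ 𝒜 g, α a = (γ g : ℂ) • a := by
  obtain ⟨T, hT, hTa⟩ := h𝒜.exists_twist hF_one hF_ne γ
  obtain ⟨T', -, hTa'⟩ := h𝒜.exists_twist hF_one hF_ne γ⁻¹
  have hcoe : ∀ g, (γ g : ℂ) * ((γ⁻¹ g : Circle) : ℂ) = 1 := fun g => by
    rw [← Circle.coe_mul]; simp
  have hl : T'.comp T = ContinuousLinearMap.id ℂ A := h𝒜.continuousLinearMap_ext fun g a ha => by
    simp [hTa g a ha, hTa' g a ha, smul_smul]
  have hr : T.comp T' = ContinuousLinearMap.id ℂ A := h𝒜.continuousLinearMap_ext fun g a ha => by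
    simp [hTa g a ha, hTa' g a ha, smul_smul]
  have hmul : ∀ a b, T (a * b) = T a * T b := by
    refine fun a => h𝒜.induction_on (isClosed_eq (by fun_prop) (by fun_prop)) (fun b c hb hc => by
      rw [mul_add, map_add, map_add, mul_add, hb, hc]) fun h b hb => ?_
    revert a
    refine h𝒜.induction_on (isClosed_eq (by fun_prop) (by fun_prop)) (fun a c ha hc => by
      rw [add_mul, map_add, map_add, add_mul, ha, hc]) fun g a ha => ?_
    rw [hTa _ _ (h𝒜.mul_mem ha hb), hTa _ _ ha, hTa _ _ hb, smul_mul_smul_comm, map_mul,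
      Circle.coe_mul]
  have hstar : ∀ a, T (star a) = star (T a) := by
    refine h𝒜.induction_on (isClosed_eq (by fun_prop) (by fun_prop)) (fun a b ha hb => by
      rw [star_add, map_add, map_add, star_add, ha, hb]) fun g a ha => ?_
    rw [hTa _ _ (h𝒜.star_mem ha), hTa _ _ ha, star_smul, map_inv, Circle.coe_inv_eq_conj,
      starRingEnd_apply]
  exact ⟨{  toFun := T
            invFun := T'
            left_inv := fun a => congr($hl a)
            right_inv := fun a => congr($hr a)
            map_mul' := hmul
            map_add' := map_add T
            map_star' := hstar
            map_smul' := map_smul T }, hT, hTa⟩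

theorem IsCStarGrading.apply_mem_unitFibre (h𝒜 : IsCStarGrading 𝒜)
    (hF_one : ∀ a ∈ 𝒜 1, F a = a) (hF_ne : ∀ g : G, g ≠ 1 → ∀ a ∈ 𝒜 g, F a = 0) (a : A) :
    F a ∈ 𝒜 1 := by
  revert a
  refine h𝒜.induction_on ((h𝒜.isClosed 1).preimage F.continuous)
    (fun a b ha hb => by rw [map_add]; exact add_mem ha hb) fun g a ha => ?_
  by_cases hg : g = 1
  · subst hg; rwa [hF_one a ha]
  · rw [hF_ne g hg a ha]; exact zero_mem _

theorem IsCStarGrading.exists_star_mul_self_eq_of_nonneg [PartialOrder A] [StarOrderedRing A]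
    (h𝒜 : IsCStarGrading 𝒜) {a : A} (ha : 0 ≤ a) (hmem : a ∈ 𝒜 1) :
    ∃ b ∈ h𝒜.unitFibre, a = star b * b := by
  have : IsClosed (h𝒜.unitFibre : Set A) := h𝒜.isClosed 1
  refine ⟨CFC.sqrt a, ?_, ?_⟩
  · rw [CFC.sqrt_eq_real_sqrt a]
    exact cfcₙ_mem (𝕜' := ℂ) (S := NonUnitalStarSubalgebra ℂ A) _ hmem
  · rw [(CFC.sqrt_nonneg a).isSelfAdjoint.star_eq, CFC.sqrt_mul_sqrt_self a]

theorem PontryaginDual.continuous_apply {G : Type*} [Monoid G] [TopologicalSpace G] (g : G) :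
    Continuous fun γ : PontryaginDual G => γ g :=
  (continuous_eval_const (F := C(G, Circle)) g).comp
    (ContinuousMonoidHom.isInducing_toContinuousMap G Circle).continuous

variable [TopologicalSpace G]

/-- A `⋆`-automorphism action of the dual group that multiplies each fibre by the corresponding
character values is strongly continuous, provided it is contractive. -/
theorem IsCStarGrading.isStronglyContinuousAction (h𝒜 : IsCStarGrading 𝒜)
    {α : PontryaginDual G → (A ≃⋆ₐ[ℂ] A)} (hα : ∀ γ a, ‖α γ a‖ ≤ ‖a‖)
    (hα_fibre : ∀ (γ : PontryaginDual G) (g : G), ∀ a ∈ 𝒜 g, α γ a = (γ g : ℂ) • a) :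
    IsStronglyContinuousAction α := by
  have hcont : ∀ γ, Continuous (α γ) := fun γ =>
    AddMonoidHomClass.continuous_of_bound (α γ) 1 (by simpa using hα γ)
  refine ⟨?_, fun γ χ => ?_, fun a => ?_⟩
  · refine h𝒜.induction_on (isClosed_eq (hcont 1) continuous_id)
      (fun a b ha hb => by rw [map_add, ha, hb]) fun g a ha => ?_
    simp [hα_fibre _ _ _ ha]
  · refine h𝒜.induction_on (isClosed_eq (hcont _) ((hcont γ).comp (hcont χ)))
      (fun a b ha hb => by rw [map_add, map_add, map_add, ha, hb]) fun g a ha => ?_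
    rw [hα_fibre _ _ _ ha, hα_fibre _ _ _ ha, map_smul, hα_fibre _ _ _ ha, smul_smul, mul_comm]
    rfl
  · revert a
    refine h𝒜.induction_on ?_ (fun a b ha hb => by
      simp only [map_add]; exact ha.add hb) ?_
    · rw [← isSeqClosed_iff_isClosed]
      intro u a hu hua
      refine continuous_of_uniform_approx_of_continuous fun v hv => ?_
      obtain ⟨ε, hε, hεv⟩ := Metric.mem_uniformity_dist.1 hv
      obtain ⟨n, hn⟩ := ((tendsto_iff_dist_tendsto_zero.1 hua).eventually_lt_const hε).exists
      refine ⟨_, hu n, fun γ => hεv ?_⟩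
      rw [dist_eq_norm, ← map_sub]
      refine (hα γ _).trans_lt ?_
      rwa [← dist_eq_norm, dist_comm]
    · intro g a ha
      simp only [hα_fibre _ _ _ ha]
      exact (continuous_subtype_val.comp (PontryaginDual.continuous_apply g)).smul continuous_const

/-! ### Haar averaging -/

variable [DiscreteTopology G]

instance : (dualHaar G).IsHaarMeasure := by unfold dualHaar; infer_instance

instance : IsProbabilityMeasure (dualHaar G) :=
  ⟨by simpa [dualHaar] using Measure.haarMeasure_self (G := PontryaginDual G) (K₀ := ⊤)⟩

/-- Translation by `χ` with `χ g ≠ 1` multiplies the integral by `χ g` yet leaves it unchanged. -/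
theorem integral_dualHaar_apply {g : G} (hg : g ≠ 1) : ∫ γ, (γ g : ℂ) ∂(dualHaar G) = 0 := by
  obtain ⟨χ, hχ⟩ := PontryaginDual.exists_apply_ne_one hg
  have h := integral_mul_left_eq_self (μ := dualHaar G) (fun γ => (γ g : ℂ)) χ
  have hmul : ∀ γ : PontryaginDual G, ((χ * γ) g : ℂ) = χ g * γ g := fun γ => rfl
  simp only [hmul, integral_const_mul] at h
  by_contra hne
  exact hχ (Circle.ext (mul_right_cancel₀ hne (by rw [h, Circle.coe_one, one_mul])))

/-- A continuous function on the compact dual group is Haar integrable. -/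
theorem Continuous.integrable_dualHaar {E : Type*} [NormedAddCommGroup E]
    {f : PontryaginDual G → E} (hf : Continuous f) : Integrable f (dualHaar G) :=
  hf.integrable_of_hasCompactSupport (HasCompactSupport.of_compactSpace f)

theorem IsCStarGrading.apply_eq_integral (h𝒜 : IsCStarGrading 𝒜)
    (hF_one : ∀ a ∈ 𝒜 1, F a = a) (hF_ne : ∀ g : G, g ≠ 1 → ∀ a ∈ 𝒜 g, F a = 0)
    {α : PontryaginDual G → (A ≃⋆ₐ[ℂ] A)} (hα : ∀ γ a, ‖α γ a‖ ≤ ‖a‖)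
    (hα_cont : ∀ a, Continuous fun γ => α γ a)
    (hα_fibre : ∀ (γ : PontryaginDual G) (g : G), ∀ a ∈ 𝒜 g, α γ a = (γ g : ℂ) • a) (a : A) :
    F a = ∫ γ, α γ a ∂(dualHaar G) := by
  have hint := fun a => (hα_cont a).integrable_dualHaar
  let I : A →L[ℂ] A := LinearMap.mkContinuous
    { toFun := fun a => ∫ γ, α γ a ∂(dualHaar G)
      map_add' := fun a b => by simp only [map_add, integral_add (hint a) (hint b)]
      map_smul' := fun c a => by simp only [map_smul, integral_smul, RingHom.id_apply] } 1
    fun a => (norm_integral_le_of_norm_le_const (ae_of_all _ fun γ => hα γ a)).trans (by simp)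
  suffices h : F = I from congr($h a)
  refine h𝒜.continuousLinearMap_ext fun g a ha => ?_
  change F a = ∫ γ, α γ a ∂(dualHaar G)
  simp only [hα_fibre _ _ _ ha, integral_smul_const]
  by_cases hg : g = 1
  · subst hg; simp [hF_one a ha]
  · rw [integral_dualHaar_apply hg, zero_smul, hF_ne g hg a ha]

/-- The Haar average of a continuous function with nonnegative values vanishes only if the
function does. -/
theorem eq_zero_of_integral_dualHaar_eq_zero [PartialOrder A] [StarOrderedRing A]
    {f : PontryaginDual G → A} (hf : Continuous f) (hf0 : ∀ γ, 0 ≤ f γ)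
    (h : ∫ γ, f γ ∂(dualHaar G) = 0) (χ : PontryaginDual G) : f χ = 0 := by
  by_contra hne
  have hpos : 0 < ‖f χ‖ / 2 := half_pos (norm_pos_iff.2 hne)
  let U : Set (PontryaginDual G) := {γ | ‖f γ - f χ‖ < ‖f χ‖ / 2}
  have hU : IsOpen U := isOpen_lt (by fun_prop) (by fun_prop)
  have hμ : 0 < (dualHaar G).real U :=
    ENNReal.toReal_pos (hU.measure_pos _ ⟨χ, by simpa [U] using hpos⟩).ne' (measure_ne_top _ _)
  have hint := hf.integrable_dualHaar
  -- Positivity squeezes the integral over `U` between zero and the full integral. But on `U` the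
  -- values stay within `‖f χ‖ / 2` of `f χ`, so their mean cannot vanish.
  have hz : ∫ γ in U, f γ ∂(dualHaar G) = 0 :=
    le_antisymm (h ▸ setIntegral_le_integral hint (ae_of_all _ hf0))
      (integral_nonneg hf0)
  have hsub : ∫ γ in U, (f γ - f χ) ∂(dualHaar G) = -((dualHaar G).real U • f χ) := by
    rw [integral_sub hint.integrableOn (integrable_const _).integrableOn, hz, setIntegral_const,
      zero_sub]
  have hle := norm_setIntegral_le_of_norm_le_const (μ := dualHaar G) (s := U)
    (f := fun γ => f γ - f χ) (measure_lt_top _ _) fun γ hγ => (show ‖f γ - f χ‖ < _ from hγ).le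
  rw [hsub, norm_neg, norm_smul, Real.norm_of_nonneg hμ.le, mul_comm] at hle
  have := le_of_mul_le_mul_right hle hμ
  linarith

end

theorem mainTheorem2 {G A : Type*} [CommGroup G] [TopologicalSpace G] [DiscreteTopology G]
    [NonUnitalCStarAlgebra A] (𝒜 : G → Submodule ℂ A) (h𝒜 : IsCStarGrading 𝒜)
    (F : A →L[ℂ] A) (hF_one : ∀ a ∈ 𝒜 1, F a = a)
    (hF_ne : ∀ g : G, g ≠ 1 → ∀ a ∈ 𝒜 g, F a = 0) :
    IsConditionalExpectation h𝒜.unitFibre F ∧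
    (∀ a : A, F (star a * a) = 0 → a = 0) ∧
    ∃ α : PontryaginDual G → (A ≃⋆ₐ[ℂ] A), IsStronglyContinuousAction α ∧
      (∀ (γ : PontryaginDual G) (g : G), ∀ a ∈ 𝒜 g, α γ a = (γ g : ℂ) • a) ∧
      ∀ a : A, F a = ∫ γ, α γ a ∂(dualHaar G) := by
  choose α hα hα_fibre using fun γ : PontryaginDual G =>
    h𝒜.exists_starAlgEquiv hF_one hF_ne (MonoidHomClass.toMonoidHom γ)
  have hact := h𝒜.isStronglyContinuousAction hα hα_fibre
  have hFint := h𝒜.apply_eq_integral hF_one hF_ne hα hact.continuous hα_fibre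
  let _ := CStarAlgebra.spectralOrder A
  have := CStarAlgebra.spectralOrderedRing A
  have hnonneg : ∀ a γ, 0 ≤ α γ (star a * a) := fun a γ => by
    rw [map_mul, map_star]; exact star_mul_self_nonneg _
  refine ⟨⟨h𝒜.isClosed 1, h𝒜.apply_mem_unitFibre hF_one hF_ne, hF_one, fun a => ?_, fun a => ?_,
    fun b hb => ?_, fun b hb => ?_⟩, fun a ha => ?_, α, hact, hα_fibre, hFint⟩
  · rw [hFint]
    exact (norm_integral_le_of_norm_le_const (ae_of_all _ fun γ => hα γ a)).trans (by simp)
  · refine h𝒜.exists_star_mul_self_eq_of_nonneg ?_ (h𝒜.apply_mem_unitFibre hF_one hF_ne _)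
    rw [hFint]
    exact integral_nonneg (hnonneg a)
  · refine h𝒜.induction_on (isClosed_eq (by fun_prop) (by fun_prop)) (fun a c ha hc => by
      rw [mul_add, map_add, map_add, mul_add, ha, hc]) fun g a ha => ?_
    have hmem : b * a ∈ 𝒜 g := by simpa using h𝒜.mul_mem (g := 1) hb ha
    by_cases hg : g = 1
    · subst hg; rw [hF_one _ hmem, hF_one _ ha]
    · rw [hF_ne g hg _ hmem, hF_ne g hg _ ha, mul_zero]
  · refine h𝒜.induction_on (isClosed_eq (by fun_prop) (by fun_prop)) (fun a c ha hc => by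
      rw [add_mul, map_add, map_add, add_mul, ha, hc]) fun g a ha => ?_
    have hmem : a * b ∈ 𝒜 g := by simpa using h𝒜.mul_mem (h := 1) ha hb
    by_cases hg : g = 1
    · subst hg; rw [hF_one _ hmem, hF_one _ ha]
    · rw [hF_ne g hg _ hmem, hF_ne g hg _ ha, zero_mul]
  -- The integrand `α γ (star a * a)` vanishes identically; its value at the trivial character is
  -- `star a * a`.
  · rw [hFint] at ha
    have h := eq_zero_of_integral_dualHaar_eq_zero (hact.continuous _) (hnonneg a) ha 1
    rw [hact.map_one] at h
    exact CStarRing.star_mul_self_eq_zero_iff a |>.1 h
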